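/- Let $p$ be a prime number and let $R$ be an integral domain of characteristic zero such that the natural map $R\to\varprojlim_n R/p^nR$ is an isomorphism, and such that there is a ring endomorphism $F$ of $R$ with $F(r)\equiv r^p \bmod pR$ for all $r\in R$. Let $N$ be the field of fractions of $R$, $N^c$ an algebraic closure of $N$, and $G$ a finite group. Write $R_n=R/p^nR$. For a ring $S$ put $\mathrm K_1(S)=\mathrm{GL}(S)/\mathrm E(S)$, where $\mathrm{GL}(S)=\varinjlim \mathrm{GL}_m(S)$ and $\mathrm E(S)$ is the subgroup generated by the elementary matrices. Let $$\mathrm{Det}:\mathrm K_1(R[G])\to\prod_\chi N^{c\times}$$ be the homomorphism whose component at an irreducible $N^c$-valued character $\chi$ of $G$ sends the class of a matrix $x$ to $\det(T_\chi(x))$, where $T_\chi$ is a representation with character $\chi$ extended $R$-linearly to $R[G]$ and entrywise to matrices. Write $\mathrm{Det}(\mathrm{GL}(R[G]))=\mathrm{Det}(\mathrm K_1(R[G]))$ for its image and $\mathrm{SK}_1(R[G])$ for its kernel. Let $1+p^n\mathrm M(R[G])=\ker(\mathrm{GL}(R[G])\to\mathrm{GL}(R_n[G]))$, and define $$\widehat{\mathrm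 K}_1(R[G])=\varprojlim_n \mathrm K_1(R_n[G]),\qquad \widehat{\mathrm{Det}}(\mathrm K_1(R[G]))=\varprojlim_n \frac{\mathrm{Det}(\mathrm{GL}(R[G]))}{\mathrm{Det}(1+p^n\mathrm M(R[G]))},$$ and let $\widehat{\mathrm{SK}}_1(R[G])$ be the closure of the image of $\mathrm{SK}_1(R[G])$ in $\widehat{\mathrm K}_1(R[G])$ for the inverse limit topology (each $\mathrm K_1(R_n[G])$ being discrete). Then: 1. The natural map $\mathrm{Det}(\mathrm K_1(R[G]))\to\widehat{\mathrm{Det}}(\mathrm K_1(R[G]))$ is an isomorphism of groups. 2. For every $n$ there is a unique homomorphism $\mathrm K_1(R_n[G])\to \mathrm{Det}(\mathrm{GL}(R[G]))/\mathrm{Det}(1+p^n\mathrm M(R[G]))$ which sends the image of each $x\in \mathrm K_1(R[G])$ to the class of $\mathrm{Det}(x)$. These homomorphisms induce a homomorphism on inverse limits, for which the sequence $$1\to\widehat{\mathrm{SK}}_1(R[G])\to\widehat{\mathrm K}_1(R[G])\to\widehat{\mathrm{Det}}(\mathrm K_1(R[G]))\to 1$$ is exact. -/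

import Mathlib

noncomputable section

namespace GroupRingK1

open Matrix (fromBlocks fromBlocks_multiply)

/-! ### The stable general linear group `GL(S) = lim GL_n(S)` -/

/-- `GL_n(S)` for an arbitrary (not necessarily commutative) ring `S`. -/
abbrev GLn (S : Type*) [Ring S] (n : ℕ) : Type _ := (Matrix (Fin n) (Fin n) S)ˣ

/-- For `n ≤ m`, the identification `{0, …, n-1} ⊔ {0, …, m-n-1} = {0, …, m-1}`. -/
def stabEquiv {n m : ℕ} (h : n ≤ m) : Fin n ⊕ Fin (m - n) ≃ Fin m :=
  finSumFinEquiv.trans (finCongr (Nat.add_sub_of_le h))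

/-- The embedding `A ↦ diag(A, 1)` of `n × n` matrices into `m × m` matrices, `n ≤ m`. -/
def stabMat (S : Type*) [Ring S] {n m : ℕ} (h : n ≤ m) :
    Matrix (Fin n) (Fin n) S →* Matrix (Fin m) (Fin m) S where
  toFun A := Matrix.reindex (stabEquiv h) (stabEquiv h) (fromBlocks A 0 0 1)
  map_one' := by simp
  map_mul' A B := by
    have : fromBlocks (A * B) 0 0 (1 : Matrix (Fin (m - n)) (Fin (m - n)) S) =
        fromBlocks A 0 0 1 * fromBlocks B 0 0 1 := by simp [fromBlocks_multiply]
    rw [this]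
    simp [Matrix.submatrix_mul_equiv]

theorem stabMat_apply {S : Type*} [Ring S] {n m : ℕ} (h : n ≤ m)
    (A : Matrix (Fin n) (Fin n) S) (i j : Fin m) :
    stabMat S h A i j = if hij : i.val < n ∧ j.val < n then A ⟨i, hij.1⟩ ⟨j, hij.2⟩
      else if i = j then 1 else 0 := by
  obtain ⟨i, rfl⟩ := (stabEquiv h).surjective i
  obtain ⟨j, rfl⟩ := (stabEquiv h).surjective j
  rcases i with i | i <;> rcases j with j | j <;>
    simp [stabMat, stabEquiv, Matrix.one_apply, Fin.ext_iff]
  · omega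
  · omega

/-- The transition map `GL_n(S) → GL_m(S)`, `A ↦ diag(A, 1)`. -/
def stab (S : Type*) [Ring S] (n m : ℕ) (h : n ≤ m) : GLn S n →* GLn S m :=
  Units.map (stabMat S h)

instance instDirectedSystemStab (S : Type*) [Ring S] :
    DirectedSystem (GLn S) (fun n m h => (stab S n m h : GLn S n → GLn S m)) where
  map_self n A := by
    ext i j
    simp [stab, stabMat_apply]
  map_map k j i hij hjk A := by
    ext a b
    simp only [stab, Units.coe_map, stabMat_apply]
    by_cases h1 : a.val < i ∧ b.val < i
    · have h2 : a.val < j ∧ b.val < j := by omega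
      simp [h1, h2]
    · by_cases h2 : a.val < j ∧ b.val < j
      · simp [h1, h2, Fin.ext_iff]
      · simp [h1, h2]

/-- The stable general linear group `GL(S)`, the direct limit of the `GL_n(S)`. -/
abbrev StGL (S : Type*) [Ring S] : Type _ := DirectLimit (GLn S) (stab S)

/-- The class in `GL(S)` of an element of `GL_n(S)`. -/
def StGL.of (S : Type*) [Ring S] (n : ℕ) : GLn S n →* StGL S where
  toFun A := ⟦⟨n, A⟩⟧
  map_one' := (DirectLimit.one_def n).symm
  map_mul' A B := (DirectLimit.mul_def n A B).symm

theorem StGL.of_stab {S : Type*} [Ring S] {n m : ℕ} (h : n ≤ m) (A : GLn S n) :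
    StGL.of S m (stab S n m h A) = StGL.of S n A :=
  Quotient.sound ⟨m, le_rfl, h, by
    simpa using DirectedSystem.map_self' (f := stab S) (stab S n m h A)⟩

theorem StGL.exists_of {S : Type*} [Ring S] (x : StGL S) : ∃ n A, StGL.of S n A = x := by
  obtain ⟨n, A, rfl⟩ := DirectLimit.exists_eq_mk _ x
  exact ⟨n, A, rfl⟩

/-- A compatible family of homomorphisms on the `GL_n(S)` gives a homomorphism on `GL(S)`. -/
def StGL.lift {S : Type*} [Ring S] {H : Type*} [Group H] (f : ∀ n, GLn S n →* H)
    (hf : ∀ n m (h : n ≤ m) (A : GLn S n), f m (stab S n m h A) = f n A) : StGL S →* H where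
  toFun := DirectLimit.lift (stab S) (fun n A => f n A) (fun n m h A => (hf n m h A).symm)
  map_one' := DirectLimit.lift_one (f := stab S) f _
  map_mul' x y := DirectLimit.lift_mul (f := stab S) f _ x y

@[simp] theorem StGL.lift_of {S : Type*} [Ring S] {H : Type*} [Group H] (f : ∀ n, GLn S n →* H)
    (hf : ∀ n m (h : n ≤ m) (A : GLn S n), f m (stab S n m h A) = f n A) (n : ℕ) (A : GLn S n) :
    StGL.lift f hf (StGL.of S n A) = f n A := rfl

/-- Entrywise application of a ring homomorphism, `GL(S) → GL(T)`. -/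
def StGL.map {S T : Type*} [Ring S] [Ring T] (f : S →+* T) : StGL S →* StGL T :=
  StGL.lift (fun n => (StGL.of T n).comp (Units.map (RingHom.mapMatrix f).toMonoidHom)) (by
    intro n m h A
    rw [MonoidHom.comp_apply, MonoidHom.comp_apply, ← StGL.of_stab h]
    congr 1
    ext i j
    change f (stabMat S h A.val i j) = stabMat T h (A.val.map f) i j
    rw [stabMat_apply, stabMat_apply]
    split_ifs <;> simp)

@[simp] theorem StGL.map_of {S T : Type*} [Ring S] [Ring T] (f : S →+* T) (n : ℕ) (A : GLn S n) :
    StGL.map f (StGL.of S n A) = StGL.of T n (Units.map (RingHom.mapMatrix f).toMonoidHom A) := rfl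

theorem StGL.map_comp {S T U : Type*} [Ring S] [Ring T] [Ring U] (g : T →+* U) (f : S →+* T)
    (x : StGL S) : StGL.map (g.comp f) x = StGL.map g (StGL.map f x) := by
  obtain ⟨n, A, rfl⟩ := StGL.exists_of x
  rfl

/-! ### Elementary matrices and `K₁` -/

/-- The elementary matrix `e_ij(a) = 1 + a E_ij`, `i ≠ j`. -/
def elem {S : Type*} [Ring S] {n : ℕ} (i j : Fin n) (hij : i ≠ j) (a : S) : GLn S n where
  val := 1 + Matrix.single i j a
  inv := 1 - Matrix.single i j a
  val_inv := by
    simp [mul_sub, add_mul, Matrix.single_mul_single_of_ne, hij.symm]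
  inv_val := by
    simp [mul_add, sub_mul, Matrix.single_mul_single_of_ne, hij.symm]

/-- `E(S)`, the subgroup of `GL(S)` generated by the elementary matrices. -/
def E (S : Type*) [Ring S] : Subgroup (StGL S) :=
  Subgroup.closure
    {x | ∃ (n : ℕ) (i j : Fin n) (hij : i ≠ j) (a : S), x = StGL.of S n (elem i j hij a)}

theorem of_elem_mem {S : Type*} [Ring S] {n : ℕ} (i j : Fin n) (hij : i ≠ j) (a : S) :
    StGL.of S n (elem i j hij a) ∈ E S :=
  Subgroup.subset_closure ⟨n, i, j, hij, a, rfl⟩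

theorem stab_elem {S : Type*} [Ring S] {n m : ℕ} (h : n ≤ m) (i j : Fin n) (hij : i ≠ j) (a : S) :
    stab S n m h (elem i j hij a) =
      elem (Fin.castLE h i) (Fin.castLE h j) (by simpa [Fin.ext_iff] using hij) a := by
  ext k l
  simp only [stab, Units.coe_map, stabMat_apply, elem, Matrix.add_apply,
    Matrix.single_apply, Matrix.one_apply, Fin.ext_iff, Fin.val_castLE]
  split_ifs <;> first | rfl | (exfalso; omega) | simp

/-- A block matrix `[1 X; 0 1]` as an invertible matrix. -/
def upperBlock {S : Type*} [Ring S] {n d : ℕ} (X : Matrix (Fin n) (Fin d) S) : GLn S (n + d) where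
  val := Matrix.reindexRingEquiv S finSumFinEquiv (fromBlocks 1 X 0 1)
  inv := Matrix.reindexRingEquiv S finSumFinEquiv (fromBlocks 1 (-X) 0 1)
  val_inv := by rw [← map_mul]; simp [fromBlocks_multiply, -Matrix.coe_reindexRingEquiv]
  inv_val := by rw [← map_mul]; simp [fromBlocks_multiply, -Matrix.coe_reindexRingEquiv]

/-- A block matrix `[1 0; Y 1]` as an invertible matrix. -/
def lowerBlock {S : Type*} [Ring S] {n d : ℕ} (Y : Matrix (Fin d) (Fin n) S) : GLn S (n + d) where
  val := Matrix.reindexRingEquiv S finSumFinEquiv (fromBlocks 1 0 Y 1)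
  inv := Matrix.reindexRingEquiv S finSumFinEquiv (fromBlocks 1 0 (-Y) 1)
  val_inv := by rw [← map_mul]; simp [fromBlocks_multiply, -Matrix.coe_reindexRingEquiv]
  inv_val := by rw [← map_mul]; simp [fromBlocks_multiply, -Matrix.coe_reindexRingEquiv]

theorem upperBlock_mem {S : Type*} [Ring S] {n d : ℕ} (X : Matrix (Fin n) (Fin d) S) :
    StGL.of S (n + d) (upperBlock X) ∈ E S := by
  induction X using Matrix.induction_on' with
  | h_zero =>
    have : upperBlock (0 : Matrix (Fin n) (Fin d) S) = 1 := by
      ext1; simp [upperBlock]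
    rw [this, map_one]; exact one_mem _
  | h_add p q hp hq =>
    have : upperBlock (p + q) = upperBlock p * upperBlock q := by
      ext1
      simp only [upperBlock, Units.val_mul]
      rw [← map_mul]
      simp [fromBlocks_multiply, add_comm]
    rw [this, map_mul]; exact mul_mem hp hq
  | h_std_basis i j x =>
    have : upperBlock (Matrix.single i j x) = elem (Fin.castAdd d i) (Fin.natAdd n j)
        (by have := i.2; have := j.2; simp only [ne_eq, Fin.ext_iff, Fin.val_castAdd, Fin.val_natAdd]; omega) x := by
      ext k l
      obtain ⟨k, rfl⟩ := finSumFinEquiv.surjective k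
      obtain ⟨l, rfl⟩ := finSumFinEquiv.surjective l
      rcases k with k | k <;> rcases l with l | l <;>
        simp [upperBlock, elem, Matrix.single_apply, Matrix.one_apply, Fin.ext_iff] <;>
        first
        | (intros; exfalso; omega)
        | (rw [if_neg (by omega), if_neg (by omega), add_zero])
    rw [this]; exact of_elem_mem _ _ _ _

theorem lowerBlock_mem {S : Type*} [Ring S] {n d : ℕ} (Y : Matrix (Fin d) (Fin n) S) :
    StGL.of S (n + d) (lowerBlock Y) ∈ E S := by
  induction Y using Matrix.induction_on' with
  | h_zero =>
    have : lowerBlock (0 : Matrix (Fin d) (Fin n) S) = 1 := by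
      ext1; simp [lowerBlock]
    rw [this, map_one]; exact one_mem _
  | h_add p q hp hq =>
    have : lowerBlock (p + q) = lowerBlock p * lowerBlock q := by
      ext1
      simp only [lowerBlock, Units.val_mul]
      rw [← map_mul]
      simp [fromBlocks_multiply]
    rw [this, map_mul]; exact mul_mem hp hq
  | h_std_basis i j x =>
    have : lowerBlock (Matrix.single i j x) = elem (Fin.natAdd n i) (Fin.castAdd d j)
        (by have := i.2; have := j.2; simp only [ne_eq, Fin.ext_iff, Fin.val_castAdd, Fin.val_natAdd]; omega) x := by
      ext k l
      obtain ⟨k, rfl⟩ := finSumFinEquiv.surjective k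
      obtain ⟨l, rfl⟩ := finSumFinEquiv.surjective l
      rcases k with k | k <;> rcases l with l | l <;>
        simp [lowerBlock, elem, Matrix.single_apply, Matrix.one_apply, Fin.ext_iff] <;>
        first
        | (intros; exfalso; omega)
        | (rw [if_neg (by omega), if_neg (by omega), add_zero])
    rw [this]; exact of_elem_mem _ _ _ _

theorem mem_E_of_mul_eq_zero {S : Type*} [Ring S] {n d : ℕ} (X : Matrix (Fin n) (Fin d) S)
    (Y : Matrix (Fin d) (Fin n) S) (hYX : Y * X = 0) (W : GLn S n) (hW : W.val = 1 + X * Y) :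
    StGL.of S n W ∈ E S := by
  have key : stab S n (n + d) (Nat.le_add_right n d) W * (lowerBlock Y * upperBlock X) =
      upperBlock X * lowerBlock Y := by
    have h1 : (stab S n (n + d) (Nat.le_add_right n d) W).val =
        Matrix.reindexRingEquiv S finSumFinEquiv (fromBlocks W.val 0 0 1) := by
      ext k l
      obtain ⟨k, rfl⟩ := finSumFinEquiv.surjective k
      obtain ⟨l, rfl⟩ := finSumFinEquiv.surjective l
      change stabMat S _ W.val _ _ = _
      rw [stabMat_apply]
      rcases k with k | k <;> rcases l with l | l <;>
        simp [Matrix.one_apply, Fin.ext_iff] <;> omega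
    ext1
    rw [Units.val_mul, Units.val_mul, Units.val_mul, h1]
    simp only [upperBlock, lowerBlock]
    rw [← map_mul, ← map_mul, ← map_mul]
    congr 1
    have h2 : (1 + X * Y) * X = X := by
      rw [Matrix.add_mul, Matrix.one_mul, Matrix.mul_assoc, hYX, Matrix.mul_zero, add_zero]
    simp [fromBlocks_multiply, hW, hYX, h2]
  rw [← StGL.of_stab (Nat.le_add_right n d), eq_mul_inv_of_mul_eq key]
  simp only [map_mul, map_inv]
  exact mul_mem (mul_mem (upperBlock_mem X) (lowerBlock_mem Y))
    (inv_mem (mul_mem (lowerBlock_mem Y) (upperBlock_mem X)))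

instance instNormalE (S : Type*) [Ring S] : (E S).Normal where
  conj_mem e he g := by
    refine Subgroup.closure_induction (p := fun e _ => g * e * g⁻¹ ∈ E S) ?_ ?_ ?_ ?_ he
    · rintro _ ⟨n, i, j, hij, a, rfl⟩
      obtain ⟨m, u, rfl⟩ := StGL.exists_of g
      rw [← StGL.of_stab (le_max_left n m), stab_elem, ← StGL.of_stab (le_max_right n m) u,
        ← map_inv, ← map_mul, ← map_mul]
      generalize stab S m (max n m) (le_max_right n m) u = v
      obtain ⟨k, hk⟩ : ∃ k, k = Fin.castLE (le_max_left n m) i := ⟨_, rfl⟩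
      obtain ⟨l, hl⟩ : ∃ l, l = Fin.castLE (le_max_left n m) j := ⟨_, rfl⟩
      have hkl : k ≠ l := by subst hk hl; simpa [Fin.ext_iff] using hij
      simp only [← hk, ← hl]
      refine mem_E_of_mul_eq_zero (d := 1) (v.val * Matrix.single k (0 : Fin 1) a)
        (Matrix.single (0 : Fin 1) l (1 : S) * (v⁻¹).val) ?_ _ ?_
      · rw [Matrix.mul_assoc, ← Matrix.mul_assoc (v⁻¹).val, Units.inv_mul, Matrix.one_mul,
          Matrix.single_mul_single_of_ne _ _ _ _ hkl.symm]
      · rw [Matrix.mul_assoc, ← Matrix.mul_assoc (Matrix.single k (0 : Fin 1) a),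
          Matrix.single_mul_single_same, mul_one, Units.val_mul, Units.val_mul]
        simp only [elem, mul_add, add_mul, mul_one, Units.mul_inv]
        rw [Matrix.mul_assoc]
    · simp
    · intro x y _ _ hx hy
      have : g * (x * y) * g⁻¹ = (g * x * g⁻¹) * (g * y * g⁻¹) := by group
      rw [this]; exact mul_mem hx hy
    · intro x _ hx
      have : g * x⁻¹ * g⁻¹ = (g * x * g⁻¹)⁻¹ := by group
      rw [this]; exact inv_mem hx

/-- `K₁(S) = GL(S) / E(S)`. -/
def K1 (S : Type*) [Ring S] : Type _ := StGL S ⧸ E S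

instance instGroupK1 (S : Type*) [Ring S] : Group (K1 S) :=
  inferInstanceAs (Group (StGL S ⧸ E S))

/-- The quotient map `GL(S) → K₁(S)`. -/
def K1.mk (S : Type*) [Ring S] : StGL S →* K1 S := QuotientGroup.mk' (E S)

/-- A homomorphism on `GL(S)` that is trivial on elementary matrices descends to `K₁(S)`. -/
def K1.lift {S : Type*} [Ring S] {H : Type*} [Group H] (f : StGL S →* H)
    (hf : ∀ (n : ℕ) (i j : Fin n) (hij : i ≠ j) (a : S), f (StGL.of S n (elem i j hij a)) = 1) :
    K1 S →* H :=
  QuotientGroup.lift (E S) f (by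
    have : E S ≤ f.ker := by
      refine (Subgroup.closure_le _).2 ?_
      rintro _ ⟨n, i, j, hij, a, rfl⟩
      exact hf n i j hij a
    exact fun x hx => this hx)

@[simp] theorem K1.lift_mk {S : Type*} [Ring S] {H : Type*} [Group H] (f : StGL S →* H)
    (hf : ∀ (n : ℕ) (i j : Fin n) (hij : i ≠ j) (a : S), f (StGL.of S n (elem i j hij a)) = 1)
    (x : StGL S) : K1.lift f hf (K1.mk S x) = f x := rfl

/-- Functoriality of `K₁`. -/
def K1.map {S T : Type*} [Ring S] [Ring T] (f : S →+* T) : K1 S →* K1 T :=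
  K1.lift ((K1.mk T).comp (StGL.map f)) (by
    intro n i j hij a
    have : Units.map (RingHom.mapMatrix f).toMonoidHom (elem i j hij a) = elem i j hij (f a) := by
      ext k l
      change f ((1 + Matrix.single i j a) k l) = (1 + Matrix.single i j (f a)) k l
      simp only [Matrix.add_apply, Matrix.one_apply, Matrix.single_apply]
      split_ifs <;> simp
    rw [MonoidHom.comp_apply, StGL.map_of, this]
    exact (QuotientGroup.eq_one_iff _).2 (of_elem_mem i j hij (f a)))

@[simp] theorem K1.map_mk {S T : Type*} [Ring S] [Ring T] (f : S →+* T) (x : StGL S) :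
    K1.map f (K1.mk S x) = K1.mk T (StGL.map f x) := rfl

theorem K1.mk_surjective (S : Type*) [Ring S] : Function.Surjective (K1.mk S) :=
  QuotientGroup.mk'_surjective _

theorem K1.map_comp {S T U : Type*} [Ring S] [Ring T] [Ring U] (g : T →+* U) (f : S →+* T)
    (x : K1 S) : K1.map (g.comp f) x = K1.map g (K1.map f x) := by
  obtain ⟨x, rfl⟩ := K1.mk_surjective S x
  simp [StGL.map_comp]

/-- `K₁` of a ring carries the discrete topology (used below for the quotients `R/pⁿR[G]`). -/
instance instTopK1 (S : Type*) [Ring S] : TopologicalSpace (K1 S) := ⊥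

instance instDiscreteK1 (S : Type*) [Ring S] : DiscreteTopology (K1 S) := ⟨rfl⟩

/-! ### Determinants -/

/-- For a ring homomorphism `φ : S → M_m(L)`, the determinant `GL_n(S) → GL_{nm}(L) → Lˣ`. -/
def detGLn {S L : Type*} [Ring S] [Field L] {m : ℕ} (φ : S →+* Matrix (Fin m) (Fin m) L) (n : ℕ) :
    GLn S n →* Lˣ :=
  Units.map (Matrix.detMonoidHom.comp
    ((Matrix.compRingEquiv (Fin n) (Fin m) L).toMonoidHom.comp (RingHom.mapMatrix φ).toMonoidHom))

theorem detGLn_val {S L : Type*} [Ring S] [Field L] {m : ℕ} (φ : S →+* Matrix (Fin m) (Fin m) L)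
    (n : ℕ) (A : GLn S n) :
    (detGLn φ n A).val = (Matrix.comp (Fin n) (Fin n) (Fin m) (Fin m) L (A.val.map φ)).det := rfl

theorem detGLn_stab {S L : Type*} [Ring S] [Field L] {m : ℕ} (φ : S →+* Matrix (Fin m) (Fin m) L)
    (n k : ℕ) (h : n ≤ k) (A : GLn S n) : detGLn φ k (stab S n k h A) = detGLn φ n A := by
  ext1
  rw [detGLn_val, detGLn_val]
  have : Matrix.comp (Fin k) (Fin k) (Fin m) (Fin m) L ((stab S n k h A).val.map φ) =
      Matrix.reindex ((Equiv.sumProdDistrib _ _ _).symm.trans ((stabEquiv h).prodCongr (.refl _)))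
        ((Equiv.sumProdDistrib _ _ _).symm.trans ((stabEquiv h).prodCongr (.refl _)))
        (fromBlocks (Matrix.comp (Fin n) (Fin n) (Fin m) (Fin m) L (A.val.map φ)) 0 0 1) := by
    ext ⟨i, a⟩ ⟨j, b⟩
    obtain ⟨i, rfl⟩ := (stabEquiv h).surjective i
    obtain ⟨j, rfl⟩ := (stabEquiv h).surjective j
    change φ (stabMat S h A.val _ _) a b = _
    rcases i with i | i <;> rcases j with j | j <;>
      simp [stabMat, Matrix.comp_apply, Matrix.one_apply, apply_ite]
    split_ifs <;> simp_all [Matrix.one_apply]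
  rw [this, Matrix.det_reindex_self, Matrix.det_fromBlocks_zero₂₁, Matrix.det_one, mul_one]

theorem detGLn_elem {S L : Type*} [Ring S] [Field L] {m : ℕ} (φ : S →+* Matrix (Fin m) (Fin m) L)
    (n : ℕ) (i j : Fin n) (hij : i ≠ j) (a : S) : detGLn φ n (elem i j hij a) = 1 := by
  ext1
  rw [detGLn_val]
  let U : Matrix (Fin n × Fin m) (Fin m) L := Matrix.of fun x y => if x.1 = i then φ a x.2 y else 0
  let V : Matrix (Fin m) (Fin n × Fin m) L :=
    Matrix.of fun y x => if x.1 = j ∧ x.2 = y then 1 else 0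
  have h1 : Matrix.comp (Fin n) (Fin n) (Fin m) (Fin m) L ((elem i j hij a).val.map φ) =
      1 + U * V := by
    ext ⟨k, x⟩ ⟨l, y⟩
    change φ ((1 + Matrix.single i j a) k l) x y = _
    simp only [Matrix.add_apply, Matrix.one_apply, Matrix.single_apply, Matrix.mul_apply, map_add,
      U, V, Matrix.of_apply, Prod.mk.injEq]
    congr 1
    · by_cases h : k = l <;> simp [h, Matrix.one_apply]
    · by_cases hk : k = i <;> by_cases hl : l = j <;>
        simp [hk, hl, @eq_comm _ i k, @eq_comm _ j l]
  have h2 : V * U = 0 := by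
    ext x y
    rw [Matrix.mul_apply]
    refine Finset.sum_eq_zero ?_
    rintro ⟨k, z⟩ -
    simp only [U, V, Matrix.of_apply]
    by_cases hk : k = i
    · subst hk; simp [hij]
    · simp [hk]
  rw [h1, Matrix.det_one_add_mul_comm, h2, add_zero, Matrix.det_one, Units.val_one]

/-- The determinant `K₁(S) → Lˣ` attached to a ring homomorphism `φ : S → M_m(L)`. -/
def detK1 {S L : Type*} [Ring S] [Field L] {m : ℕ} (φ : S →+* Matrix (Fin m) (Fin m) L) :
    K1 S →* Lˣ :=
  K1.lift (StGL.lift (detGLn φ) (detGLn_stab φ)) (fun n i j hij a => detGLn_elem φ n i j hij a)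

/-- The irreducible `L`-valued characters of `G`. -/
def IrrChar (L G : Type*) [Field L] [Group G] : Type _ :=
  {χ : G → L // ∃ (m : ℕ) (ρ : Representation L G (Fin m → L)),
    ρ.IsIrreducible ∧ ρ.character = χ}

/-- The degree of the irreducible representation `T_χ`. -/
def IrrChar.deg {L G : Type*} [Field L] [Group G] (χ : IrrChar L G) : ℕ := χ.2.choose

/-- An irreducible representation `T_χ` with character `χ`. Over an algebraically closed field of
characteristic zero it is unique up to isomorphism, see `detK1_eq_of_character_eq`. -/
def IrrChar.rep {L G : Type*} [Field L] [Group G] (χ : IrrChar L G) :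
    Representation L G (Fin χ.deg → L) := χ.2.choose_spec.choose

/-- The `R`-linear extension `R[G] → M_m(L)` of a representation of `G` on `L^m`. -/
def repMat (R : Type*) {L G : Type*} [CommRing R] [Field L] [Algebra R L] [Group G] {m : ℕ}
    (ρ : Representation L G (Fin m → L)) : MonoidAlgebra R G →+* Matrix (Fin m) (Fin m) L :=
  (MonoidAlgebra.lift R (Matrix (Fin m) (Fin m) L) G
    ((LinearMap.toMatrixAlgEquiv' (R := L) (n := Fin m)).toAlgHom.toMonoidHom.comp ρ)).toRingHom

/-- `Det : K₁(R[G]) → ∏_χ Lˣ`, with `χ`-component `x ↦ det (T_χ(x))`; here `L` is an `R`-algebra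
which is a field and `χ` runs over the irreducible `L`-valued characters of `G`. -/
def Det (R L G : Type*) [CommRing R] [Field L] [Algebra R L] [Group G] :
    K1 (MonoidAlgebra R G) →* (IrrChar L G → Lˣ) :=
  MonoidHom.pi fun χ => detK1 (repMat R χ.rep)

theorem repMat_apply {R L G : Type*} [CommRing R] [Field L] [Algebra R L] [Group G] {m : ℕ}
    (ρ : Representation L G (Fin m → L)) (x : MonoidAlgebra R G) :
    repMat R ρ x = x.coeff.sum fun g r => r • LinearMap.toMatrix' (ρ g) := by
  change MonoidAlgebra.lift R (Matrix (Fin m) (Fin m) L) G _ x = _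
  rw [MonoidAlgebra.lift_apply]
  rfl

theorem detK1_congr {S L : Type*} [Ring S] [Field L] {m : ℕ}
    (φ ψ : S →+* Matrix (Fin m) (Fin m) L) (P Q : Matrix (Fin m) (Fin m) L) (hPQ : P * Q = 1)
    (h : ∀ s, φ s = P * ψ s * Q) (x : K1 S) : detK1 φ x = detK1 ψ x := by
  obtain ⟨x, rfl⟩ := K1.mk_surjective S x
  obtain ⟨n, A, rfl⟩ := StGL.exists_of x
  change detGLn φ n A = detGLn ψ n A
  ext1
  rw [detGLn_val, detGLn_val]
  have h1 : A.val.map φ = Matrix.diagonal (fun _ => P) * A.val.map ψ * Matrix.diagonal fun _ => Q := by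
    ext i j : 2
    simp [Matrix.mul_diagonal, Matrix.diagonal_mul, h]
  have h2 : (Matrix.diagonal fun _ : Fin n => P) * (Matrix.diagonal fun _ => Q) = 1 := by
    simp [Matrix.diagonal_mul_diagonal, hPQ]
  have h3 := congrArg (Matrix.compRingEquiv (Fin n) (Fin m) L) h2
  rw [map_mul, map_one] at h3
  change (Matrix.compRingEquiv (Fin n) (Fin m) L _).det = (Matrix.compRingEquiv (Fin n) (Fin m) L _).det
  rw [h1, map_mul, map_mul, Matrix.det_mul, Matrix.det_mul, mul_right_comm, ← Matrix.det_mul, h3,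
    Matrix.det_one, one_mul]

/-- The value of the determinant at `ρ` depends only on the character of `ρ`, so that the choice
made in `IrrChar.rep` is immaterial. -/
theorem detK1_eq_of_character_eq {R L G : Type*} [CommRing R] [Field L] [IsAlgClosed L] [CharZero L]
    [Algebra R L] [Group G] [Finite G] {m m' : ℕ} (ρ : Representation L G (Fin m → L))
    (σ : Representation L G (Fin m' → L)) (hρ : ρ.IsIrreducible) (hσ : σ.IsIrreducible)
    (h : ρ.character = σ.character) (x : K1 (MonoidAlgebra R G)) :
    detK1 (repMat R ρ) x = detK1 (repMat R σ) x := by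
  classical
  have := Fintype.ofFinite G
  have hG : (Nat.card G : L) ≠ 0 := by simp
  have := invertibleOfNonzero hG
  have h1 := Representation.char_orthonormal ρ σ
  have h2 := Representation.char_orthonormal ρ ρ
  rw [if_pos ⟨Representation.Equiv.refl ρ⟩] at h2
  rw [← h, h2] at h1
  have hne : Nonempty (Representation.Equiv σ ρ) := by
    by_contra hc
    rw [if_neg hc] at h1
    simp at h1
  obtain ⟨e⟩ := hne
  have hm : m' = m := by simpa using e.toLinearEquiv.finrank_eq
  subst hm
  let f : (Fin m' → L) ≃ₗ[L] (Fin m' → L) := e.toLinearEquiv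
  have hf : ∀ g, ρ g = f.toLinearMap ∘ₗ σ g ∘ₗ f.symm.toLinearMap := by
    intro g
    rw [← Representation.Equiv.conj_apply_self g e]
    rfl
  refine detK1_congr _ _ (LinearMap.toMatrix' f.toLinearMap) (LinearMap.toMatrix' f.symm.toLinearMap)
    ?_ ?_ x
  · rw [← LinearMap.toMatrix'_comp]; simp
  · intro s
    rw [repMat_apply, repMat_apply, Finsupp.sum, Finsupp.sum, Matrix.mul_sum, Matrix.sum_mul]
    refine Finset.sum_congr rfl fun g _ => ?_
    rw [hf, LinearMap.toMatrix'_comp, LinearMap.toMatrix'_comp, Matrix.mul_smul, Matrix.smul_mul,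
      Matrix.mul_assoc]

/-- `SK₁(R[G]) = ker (Det)`. -/
def SK1 (R L G : Type*) [CommRing R] [Field L] [Algebra R L] [Group G] :
    Subgroup (K1 (MonoidAlgebra R G)) :=
  (Det R L G).ker

/-- `Det(K₁(R[G]))`, the image of `Det`. -/
def DetK1 (R L G : Type*) [CommRing R] [Field L] [Algebra R L] [Group G] :
    Subgroup (IrrChar L G → Lˣ) :=
  (Det R L G).range

/-- `Det` as a map onto its image. -/
def Det.toImage (R L G : Type*) [CommRing R] [Field L] [Algebra R L] [Group G] :
    K1 (MonoidAlgebra R G) →* DetK1 R L G :=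
  (Det R L G).rangeRestrict

/-! ### Reduction modulo `pⁿ` and completions -/

/-- `R_n = R / pⁿ R`. -/
abbrev Rmod (R : Type*) [CommRing R] (p n : ℕ) : Type _ := R ⧸ Ideal.span {(p : R) ^ n}

/-- The reduction map `R[G] → R_n[G]`. -/
def red (R G : Type*) [CommRing R] [Group G] (p n : ℕ) :
    MonoidAlgebra R G →+* MonoidAlgebra (Rmod R p n) G :=
  MonoidAlgebra.mapRingHom G (Ideal.Quotient.mk _)

theorem span_pow_le (R : Type*) [CommRing R] (p : ℕ) {m n : ℕ} (h : m ≤ n) :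
    Ideal.span {(p : R) ^ n} ≤ Ideal.span {(p : R) ^ m} :=
  Ideal.span_singleton_le_span_singleton.2 (pow_dvd_pow _ h)

/-- The transition map `R_n[G] → R_m[G]` for `m ≤ n`. -/
def trans (R G : Type*) [CommRing R] [Group G] (p : ℕ) {m n : ℕ} (h : m ≤ n) :
    MonoidAlgebra (Rmod R p n) G →+* MonoidAlgebra (Rmod R p m) G :=
  MonoidAlgebra.mapRingHom G (Ideal.Quotient.factor (span_pow_le R p h))

theorem trans_comp_red (R G : Type*) [CommRing R] [Group G] (p : ℕ) {m n : ℕ} (h : m ≤ n) :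
    (trans R G p h).comp (red R G p n) = red R G p m := by
  ext <;> simp [trans, red]

/-- The completed group `K̂₁(R[G]) = lim K₁(R_n[G])`. It carries the inverse limit topology, that
is the topology induced by the product of the discrete groups `K₁(R_n[G])`. -/
def K1Hat (R G : Type*) [CommRing R] [Group G] (p : ℕ) :
    Subgroup (∀ n : ℕ, K1 (MonoidAlgebra (Rmod R p n) G)) where
  carrier := {x | ∀ (m n : ℕ) (h : m ≤ n), K1.map (trans R G p h) (x n) = x m}
  one_mem' := fun m n h => map_one _
  mul_mem' := fun {x y} hx hy m n h => by
    rw [Pi.mul_apply, Pi.mul_apply, map_mul, hx m n h, hy m n h]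
  inv_mem' := fun {x} hx m n h => by rw [Pi.inv_apply, Pi.inv_apply, map_inv, hx m n h]

/-- The natural map `K₁(R[G]) → K̂₁(R[G])`. -/
def K1.toHat (R G : Type*) [CommRing R] [Group G] (p : ℕ) :
    K1 (MonoidAlgebra R G) →* K1Hat R G p :=
  (MonoidHom.pi fun n => K1.map (red R G p n)).codRestrict _ (fun x m n h => by
    change K1.map (trans R G p h) (K1.map (red R G p n) x) = K1.map (red R G p m) x
    rw [← K1.map_comp, trans_comp_red])

/-- `SK̂₁(R[G])`, the closure in `K̂₁(R[G])` of (the image of) `SK₁(R[G])`. -/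
def SK1Hat (R L G : Type*) [CommRing R] [Field L] [Algebra R L] [Group G] (p : ℕ) :
    Subgroup (K1Hat R G p) :=
  ((SK1 R L G).map (K1.toHat R G p)).topologicalClosure

/-- `1 + pⁿ M(R[G])`, as a subgroup of `GL(R[G])`: the kernel of `GL(R[G]) → GL(R_n[G])`.
See `of_mem_congGL_iff` for the description through matrices. -/
def congGL (R G : Type*) [CommRing R] [Group G] (p n : ℕ) : Subgroup (StGL (MonoidAlgebra R G)) :=
  (StGL.map (red R G p n)).ker

theorem stab_injective (S : Type*) [Ring S] (n m : ℕ) (h : n ≤ m) :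
    Function.Injective (stab S n m h) := by
  intro A B hAB
  ext i j
  have := congrArg (fun C : GLn S m => C.val (Fin.castLE h i) (Fin.castLE h j)) hAB
  simpa [stab, stabMat_apply] using this

theorem StGL.of_injective (S : Type*) [Ring S] (n : ℕ) : Function.Injective (StGL.of S n) :=
  DirectLimit.mk_injective (stab S) (stab_injective S) n

theorem red_eq_zero_iff (R G : Type*) [CommRing R] [Group G] (p n : ℕ) (x : MonoidAlgebra R G) :
    red R G p n x = 0 ↔ ∃ y, x = (p ^ n : ℕ) • y := by
  constructor
  · intro h
    have h1 : ∀ g, ∃ c, x.coeff g = (p : R) ^ n * c := by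
      intro g
      have := congrArg (fun z => z.coeff g) h
      simpa [red, Ideal.Quotient.eq_zero_iff_mem, Ideal.mem_span_singleton, dvd_def] using this
    choose c hc using h1
    refine ⟨x.coeff.support.sum fun g => MonoidAlgebra.single g (c g), ?_⟩
    conv_lhs => rw [← MonoidAlgebra.sum_coeff_single x]
    rw [Finset.smul_sum, Finsupp.sum]
    refine Finset.sum_congr rfl fun g _ => ?_
    rw [hc g, MonoidAlgebra.smul_single]
    simp
  · rintro ⟨y, rfl⟩
    rw [map_nsmul]
    have h0 : ((p ^ n : ℕ) : Rmod R p n) = 0 := by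
      rw [← map_natCast (Ideal.Quotient.mk _), Ideal.Quotient.eq_zero_iff_mem]
      exact Ideal.mem_span_singleton.2 (by simp)
    rw [nsmul_eq_mul, ← map_natCast (MonoidAlgebra.singleOneRingHom (R := Rmod R p n) (M := G)), h0,
      map_zero, zero_mul]

/-- `1 + pⁿ M(R[G])` consists of the invertible matrices of the form `1 + pⁿ B`. -/
theorem of_mem_congGL_iff (R G : Type*) [CommRing R] [Group G] (p n k : ℕ)
    (A : GLn (MonoidAlgebra R G) k) :
    StGL.of _ k A ∈ congGL R G p n ↔
      ∃ B : Matrix (Fin k) (Fin k) (MonoidAlgebra R G), A.val = 1 + (p ^ n : ℕ) • B := by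
  have h1 : StGL.of _ k A ∈ congGL R G p n ↔ (RingHom.mapMatrix (red R G p n)) A.val = 1 := by
    rw [congGL, MonoidHom.mem_ker, StGL.map_of, ← map_one (StGL.of _ k),
      (StGL.of_injective _ k).eq_iff, Units.ext_iff]
    rfl
  rw [h1, ← sub_eq_zero, ← map_one (RingHom.mapMatrix (red R G p n)), ← map_sub]
  constructor
  · intro h
    have h2 : ∀ i j, ∃ y, (A.val - 1) i j = (p ^ n : ℕ) • y := fun i j =>
      (red_eq_zero_iff R G p n _).1 (congrFun (congrFun h i) j)
    choose B hB using h2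
    refine ⟨Matrix.of B, ?_⟩
    rw [← sub_eq_iff_eq_add']
    refine Matrix.ext fun i j => ?_
    exact hB i j
  · rintro ⟨B, hB⟩
    rw [hB, add_sub_cancel_left]
    refine Matrix.ext fun i j => ?_
    exact (red_eq_zero_iff R G p n _).2 ⟨B i j, rfl⟩

theorem congGL_anti (R G : Type*) [CommRing R] [Group G] (p : ℕ) {m n : ℕ} (h : m ≤ n) :
    congGL R G p n ≤ congGL R G p m := by
  intro x hx
  change StGL.map _ x = 1
  rw [← trans_comp_red R G p h, StGL.map_comp, (show StGL.map (red R G p n) x = 1 from hx), map_one]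

/-- `Det(1 + pⁿ M(R[G]))`, as a subgroup of `Det(K₁(R[G]))`. -/
def DetCong (R L G : Type*) [CommRing R] [Field L] [Algebra R L] [Group G] (p n : ℕ) :
    Subgroup (DetK1 R L G) :=
  (congGL R G p n).map ((Det.toImage R L G).comp (K1.mk _))

theorem DetCong_anti (R L G : Type*) [CommRing R] [Field L] [Algebra R L] [Group G] (p : ℕ)
    {m n : ℕ} (h : m ≤ n) : DetCong R L G p n ≤ DetCong R L G p m :=
  Subgroup.map_mono (congGL_anti R G p h)

/-- The quotient `Det(GL(R[G])) / Det(1 + pⁿ M(R[G]))`. -/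
abbrev DetMod (R L G : Type*) [CommRing R] [Field L] [Algebra R L] [Group G] (p n : ℕ) : Type _ :=
  DetK1 R L G ⧸ DetCong R L G p n

/-- The transition map `Det(GL)/Det(1 + pⁿ M) → Det(GL)/Det(1 + p^m M)` for `m ≤ n`. -/
def DetMod.trans (R L G : Type*) [CommRing R] [Field L] [Algebra R L] [Group G] (p : ℕ) {m n : ℕ}
    (h : m ≤ n) : DetMod R L G p n →* DetMod R L G p m :=
  QuotientGroup.map _ _ (MonoidHom.id _) (DetCong_anti R L G p h)

/-- The completed group `D̂et(K₁(R[G])) = lim Det(GL(R[G])) / Det(1 + pⁿ M(R[G]))`. -/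
def DetHat (R L G : Type*) [CommRing R] [Field L] [Algebra R L] [Group G] (p : ℕ) :
    Subgroup (∀ n : ℕ, DetMod R L G p n) where
  carrier := {x | ∀ (m n : ℕ) (h : m ≤ n), DetMod.trans R L G p h (x n) = x m}
  one_mem' := fun m n h => (DetMod.trans R L G p h).map_one
  mul_mem' := fun {x y} hx hy m n h => by
    rw [Pi.mul_apply, Pi.mul_apply, map_mul, hx m n h, hy m n h]
  inv_mem' := fun {x} hx m n h => by rw [Pi.inv_apply, Pi.inv_apply, map_inv, hx m n h]

/-- The natural map `Det(K₁(R[G])) → D̂et(K₁(R[G]))`. -/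
def DetK1.toHat (R L G : Type*) [CommRing R] [Field L] [Algebra R L] [Group G] (p : ℕ) :
    DetK1 R L G →* DetHat R L G p :=
  (MonoidHom.pi fun n => QuotientGroup.mk' (DetCong R L G p n)).codRestrict _
    (fun _x _m _n _h => rfl)

end GroupRingK1

end

/-!
The theorem rests on two properties of `S = R[G]`, which is finite as an `R`-module over the
`p`-adically complete ring `R`.

Since `p` lies in the Jacobson radical of `R`, Nakayama's lemma makes `1 + pⁿ b` invertible in every
finite `R`-algebra, `n ≥ 1` (`isUnit_one_add_nsmul`). Hence invertible matrices lift along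
`S → S / pⁿ`, and since elementary matrices lift as well, `K₁(S) → K₁(S / pⁿ)` is surjective with
kernel the image of `1 + pⁿ M(S)` (`K1.map_red_surjective`, `K1.ker_map_red`). So `Det` induces the
maps `K₁(S / pⁿ) → Det(GL(S)) / Det(1 + pⁿ M(S))`, uniquely, and the kernel of such a map is the
image of `SK₁(S)` (`toImage_mem_DetCong_iff`). An element of `K̂₁(S)` is therefore killed in the limit
if and only if each of its components lifts to `SK₁(S)`, that is, if and only if it lies in the
closure of `SK₁(S)` (`mem_SK1Hat_iff`). Surjectivity of `K̂₁ → D̂et` follows from that of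
`Det(K₁(S)) → D̂et(K₁(S))`.

For the latter, Gaussian elimination gives `Det(1 + pⁿ M(S)) = Det(1 + pⁿ S)` for `n ≥ 1`
(`exists_detGLn_eq_of_mem_congUnits`). An element of the completion is then represented by an
infinite product of elements of `1 + pⁿ S`, `n → ∞`, which converges in `S` because `S` is complete
(`exists_units_limit`).

For injectivity, let `d` lie in `Det(1 + pⁿ S)` for all `n ≥ 1`. Expanding
`det (1 + pⁿ T_χ(b))` shows `d_χ ∈ 1 + pⁿ W`, where `W` is the `R`-module spanned by the products of
a fixed number of elements among `1` and the entries of the `T_χ(g)`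
(`exists_fg_forall_detGLn_repMat`). As `W` is finitely generated, linear functionals to the fraction
field of `R` map it into some `b⁻¹ R`, so that the intersection of the `pⁿ W` vanishes
(`eq_zero_of_forall_exists_pow_smul`) and `d_χ = 1`.
-/

namespace GroupRingK1

/-! ### Units congruent to `1` modulo `p` in finite algebras over a complete ring -/

section Units

variable {R : Type*} [CommRing R] {p : ℕ}

/-- As `p` lies in the Jacobson radical of the `p`-adically complete ring `R`, Nakayama's lemma shows
that left and right multiplication by `1 + pⁿ b`, `n ≥ 1`, are surjective on a finite `R`-algebra. -/
theorem isUnit_one_add_nsmul [IsAdicComplete (Ideal.span {(p : R)}) R] {T : Type*} [Ring T]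
    [Algebra R T] [Module.Finite R T] {n : ℕ} (hn : n ≠ 0) (b : T) :
    IsUnit (1 + (p ^ n : ℕ) • b) := by
  have surj : ∀ f : T →ₗ[R] T, (∀ t, ∃ c, t = f t + (p : R) • c) → Function.Surjective f := by
    intro f hf
    rw [← LinearMap.range_eq_top, eq_top_iff]
    refine Submodule.le_of_le_smul_of_le_jacobson_bot (I := Ideal.span {(p : R)})
      Module.Finite.fg_top (IsAdicComplete.le_jacobson_bot _) ?_
    intro t _
    obtain ⟨c, hc⟩ := hf t
    rw [hc]
    exact Submodule.add_mem_sup ⟨t, rfl⟩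
      (Submodule.smul_mem_smul (Ideal.mem_span_singleton_self _) trivial)
  obtain ⟨k, rfl⟩ := Nat.exists_eq_succ_of_ne_zero hn
  have hb : (p ^ k.succ : ℕ) • b = (p : R) • (p ^ k : ℕ) • b := by
    rw [Nat.cast_smul_eq_nsmul, smul_smul, pow_succ']
  obtain ⟨c, hc⟩ := surj (LinearMap.mulLeft R (1 + (p ^ k.succ : ℕ) • b))
    (fun t => ⟨-((p ^ k : ℕ) • b * t), by
      rw [LinearMap.mulLeft_apply, hb, add_mul, one_mul, smul_neg, smul_mul_assoc]; abel⟩) 1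
  obtain ⟨d, hd⟩ := surj (LinearMap.mulRight R (1 + (p ^ k.succ : ℕ) • b))
    (fun t => ⟨-(t * (p ^ k : ℕ) • b), by
      rw [LinearMap.mulRight_apply, hb, mul_add, mul_one, smul_neg, mul_smul_comm]; abel⟩) 1
  rw [LinearMap.mulLeft_apply] at hc
  rw [LinearMap.mulRight_apply] at hd
  exact ⟨⟨_, c, hc, by rwa [← left_inv_eq_right_inv hd hc]⟩, rfl⟩

/-- Units lift along a surjection whose kernel consists of multiples of `pⁿ`, `n ≥ 1`. -/
theorem isUnit_of_isUnit_map [IsAdicComplete (Ideal.span {(p : R)}) R] {T U : Type*} [Ring T]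
    [Algebra R T] [Module.Finite R T] [Ring U] {n : ℕ} (hn : n ≠ 0) (f : T →+* U)
    (hf : Function.Surjective f) (hker : ∀ x, f x = 0 → ∃ y, x = (p ^ n : ℕ) • y) {a : T}
    (ha : IsUnit (f a)) : IsUnit a := by
  obtain ⟨c, hc⟩ := hf ha.unit⁻¹.val
  have key : ∀ x, f x = 1 → IsUnit x := by
    intro x hx
    obtain ⟨y, hy⟩ := hker (x - 1) (by simp [hx])
    rw [← add_sub_cancel 1 x, hy]
    exact isUnit_one_add_nsmul (R := R) hn y
  have h1 := key (a * c) (by simp [hc])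
  have h2 := key (c * a) (by simp [hc])
  exact isUnit_iff_exists_and_exists.2
    ⟨⟨c * h1.unit⁻¹.val, by rw [← mul_assoc]; exact h1.mul_val_inv⟩,
      ⟨h2.unit⁻¹.val * c, by rw [mul_assoc]; exact h2.val_inv_mul⟩⟩

end Units

/-! ### Reduction modulo `pⁿ` on `GL` and `K₁` -/

section Reduction

theorem red_surjective (R G : Type*) [CommRing R] [Group G] (p n : ℕ) :
    Function.Surjective (red R G p n) := by
  intro x
  induction x using MonoidAlgebra.induction_linear with
  | zero => exact ⟨0, map_zero _⟩
  | add x y hx hy =>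
    obtain ⟨a, rfl⟩ := hx
    obtain ⟨b, rfl⟩ := hy
    exact ⟨a + b, map_add _ _ _⟩
  | single g r =>
    obtain ⟨r, rfl⟩ := Ideal.Quotient.mk_surjective r
    exact ⟨MonoidAlgebra.single g r, by simp [red]⟩

variable {R G : Type*} [CommRing R] [Group G] {p : ℕ}

/-- Elementary matrices lift to elementary matrices. -/
theorem exists_mem_E_map_red_eq (n : ℕ) {x : StGL (MonoidAlgebra (Rmod R p n) G)}
    (hx : x ∈ E (MonoidAlgebra (Rmod R p n) G)) :
    ∃ e ∈ E (MonoidAlgebra R G), StGL.map (red R G p n) e = x := by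
  suffices h : E (MonoidAlgebra (Rmod R p n) G) ≤
      (E (MonoidAlgebra R G)).map (StGL.map (red R G p n)) from h hx
  refine (Subgroup.closure_le _).2 ?_
  rintro _ ⟨k, i, j, hij, a, rfl⟩
  obtain ⟨a, rfl⟩ := red_surjective R G p n a
  refine ⟨_, of_elem_mem i j hij a, ?_⟩
  rw [StGL.map_of]
  congr 1
  refine Units.ext (Matrix.ext fun s t => ?_)
  change red R G p n ((1 + Matrix.single i j a) s t) =
    (1 + Matrix.single i j (red R G p n a)) s t
  simp only [Matrix.add_apply, Matrix.one_apply, Matrix.single_apply]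
  split_ifs <;> simp

/-- The kernel of `K₁(R[G]) → K₁(R_n[G])` is the image of `1 + pⁿ M(R[G])`. -/
theorem K1.ker_map_red (n : ℕ) :
    (K1.map (red R G p n)).ker = (congGL R G p n).map (K1.mk _) := by
  ext x
  constructor
  · intro hx
    obtain ⟨x, rfl⟩ := K1.mk_surjective _ x
    obtain ⟨e, he, hex⟩ := exists_mem_E_map_red_eq n ((QuotientGroup.eq_one_iff _).1 hx)
    refine ⟨x * e⁻¹, ?_, ?_⟩
    · change StGL.map _ _ = 1
      rw [map_mul, map_inv, hex, mul_inv_cancel]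
    · have h : K1.mk _ e = 1 := (QuotientGroup.eq_one_iff _).2 he
      rw [map_mul, map_inv, h, inv_one, mul_one]
  · rintro ⟨y, hy, rfl⟩
    change K1.map _ (K1.mk _ y) = 1
    rw [K1.map_mk, show StGL.map (red R G p n) y = 1 from hy, map_one]

variable [Finite G] [IsAdicComplete (Ideal.span {(p : R)}) R]

theorem StGL.map_red_surjective (n : ℕ) : Function.Surjective (StGL.map (red R G p n)) := by
  intro x
  obtain ⟨k, A, rfl⟩ := StGL.exists_of x
  rcases eq_or_ne n 0 with rfl | hn
  · -- `R₀[G]` is the zero ring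
    have : Subsingleton (Rmod R p 0) := Ideal.Quotient.subsingleton_iff.2 (by simp)
    have : Subsingleton (MonoidAlgebra (Rmod R p 0) G) :=
      MonoidAlgebra.coeff_injective.subsingleton
    exact ⟨1, by rw [map_one, Subsingleton.elim A 1, map_one]⟩
  choose B hB using fun i j => red_surjective R G p n (A.val i j)
  have hBA : RingHom.mapMatrix (red R G p n) (Matrix.of B) = A.val := Matrix.ext hB
  have hu : IsUnit (Matrix.of B) := by
    refine isUnit_of_isUnit_map (R := R) (p := p) hn (RingHom.mapMatrix (red R G p n)) ?_ ?_
      (hBA ▸ A.isUnit)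
    · intro C
      choose D hD using fun i j => red_surjective R G p n (C i j)
      exact ⟨Matrix.of D, Matrix.ext hD⟩
    · intro C hC
      choose D hD using fun i j => (red_eq_zero_iff R G p n (C i j)).1 (congrFun₂ hC i j)
      exact ⟨Matrix.of D, Matrix.ext hD⟩
  exact ⟨StGL.of _ k hu.unit, by rw [StGL.map_of]; congr 1; exact Units.ext hBA⟩

theorem K1.map_red_surjective (n : ℕ) : Function.Surjective (K1.map (red R G p n)) := by
  intro x
  obtain ⟨x, rfl⟩ := K1.mk_surjective _ x
  obtain ⟨y, rfl⟩ := StGL.map_red_surjective n x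
  exact ⟨K1.mk _ y, rfl⟩

end Reduction

/-! ### Elimination in congruence subgroups -/

section Elimination

open Matrix (fromBlocks fromBlocks_multiply)

/-- The subgroup `(1 + pⁿ T) ∩ Tˣ` of the units of a ring `T`. -/
def congUnits (T : Type*) [Ring T] (p n : ℕ) : Subgroup Tˣ where
  carrier := {u | ∃ b : T, u.val = 1 + (p ^ n : ℕ) • b}
  one_mem' := ⟨0, by simp⟩
  mul_mem' := by
    rintro u v ⟨b, hb⟩ ⟨c, hc⟩
    refine ⟨b * v.val + c, ?_⟩
    rw [Units.val_mul, hb, add_mul, one_mul, smul_mul_assoc, smul_add, hc]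
    abel
  inv_mem' := by
    rintro u ⟨b, hb⟩
    refine ⟨-(u⁻¹.val * b), ?_⟩
    have h := u.inv_mul
    rw [hb, mul_add, mul_one, mul_smul_comm] at h
    rw [smul_neg, ← sub_eq_add_neg, ← h, add_sub_cancel_right]

theorem of_mem_congGL_iff_mem_congUnits (R G : Type*) [CommRing R] [Group G] (p n k : ℕ)
    (A : GLn (MonoidAlgebra R G) k) : StGL.of _ k A ∈ congGL R G p n ↔ A ∈ congUnits _ p n :=
  of_mem_congGL_iff R G p n k A

variable {S : Type*} [Ring S]

/-- The block diagonal matrix `diag(A, D)`. -/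
def blockDiag {n d : ℕ} (A : GLn S n) (D : GLn S d) : GLn S (n + d) where
  val := Matrix.reindexRingEquiv S finSumFinEquiv (fromBlocks A.val 0 0 D.val)
  inv := Matrix.reindexRingEquiv S finSumFinEquiv (fromBlocks A⁻¹.val 0 0 D⁻¹.val)
  val_inv := by rw [← map_mul]; simp [fromBlocks_multiply, -Matrix.coe_reindexRingEquiv]
  inv_val := by rw [← map_mul]; simp [fromBlocks_multiply, -Matrix.coe_reindexRingEquiv]

variable {L : Type*} [Field L] {m : ℕ}

theorem detGLn_blockDiag (φ : S →+* Matrix (Fin m) (Fin m) L) {n d : ℕ} (A : GLn S n)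
    (D : GLn S d) : detGLn φ (n + d) (blockDiag A D) = detGLn φ n A * detGLn φ d D := by
  ext1
  rw [Units.val_mul, detGLn_val, detGLn_val, detGLn_val]
  have : Matrix.comp (Fin (n + d)) (Fin (n + d)) (Fin m) (Fin m) L ((blockDiag A D).val.map φ) =
      Matrix.reindex ((Equiv.sumProdDistrib _ _ _).symm.trans (finSumFinEquiv.prodCongr (.refl _)))
        ((Equiv.sumProdDistrib _ _ _).symm.trans (finSumFinEquiv.prodCongr (.refl _)))
        (fromBlocks (Matrix.comp (Fin n) (Fin n) (Fin m) (Fin m) L (A.val.map φ)) 0 0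
          (Matrix.comp (Fin d) (Fin d) (Fin m) (Fin m) L (D.val.map φ))) := by
    ext ⟨i, a⟩ ⟨j, b⟩
    obtain ⟨i, rfl⟩ := finSumFinEquiv.surjective i
    obtain ⟨j, rfl⟩ := finSumFinEquiv.surjective j
    rcases i with i | i <;> rcases j with j | j <;>
      simp [blockDiag, Matrix.comp_apply]
  rw [this, Matrix.det_reindex_self, Matrix.det_fromBlocks_zero₂₁]

theorem detGLn_of_mem_E (φ : S →+* Matrix (Fin m) (Fin m) L) {n : ℕ} {A : GLn S n}
    (hA : StGL.of S n A ∈ E S) : detGLn φ n A = 1 := by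
  have h : K1.mk S (StGL.of S n A) = 1 := (QuotientGroup.eq_one_iff _).2 hA
  exact (congrArg (detK1 φ) h).trans (map_one _)

/-- Gaussian elimination: a matrix congruent to `1` modulo `pⁿ`, `n ≥ 1`, has invertible pivots,
so that it is a product of block unitriangular matrices and of a diagonal matrix. The
point is that the size of the matrix becomes bounded. -/
theorem exists_detGLn_eq_of_mem_congUnits (L : Type*) [Field L] {R : Type*} [CommRing R] {p : ℕ}
    [IsAdicComplete (Ideal.span {(p : R)}) R] [Algebra R S] [Module.Finite R S] {n : ℕ}
    (hn : n ≠ 0) (k : ℕ) (A : GLn S k) (hA : A ∈ congUnits _ p n) :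
    ∃ u : GLn S 1, u ∈ congUnits _ p n ∧
      ∀ (m : ℕ) (φ : S →+* Matrix (Fin m) (Fin m) L), detGLn φ k A = detGLn φ 1 u := by
  have fin : ∀ l : ℕ, Module.Finite R (Matrix (Fin l) (Fin l) S) :=
    fun l => inferInstanceAs (Module.Finite R (Fin l → Fin l → S))
  induction k with
  | zero => exact ⟨1, one_mem _, fun m φ => by rw [Subsingleton.elim A 1, map_one, map_one]⟩
  | succ k ih =>
    obtain ⟨B, hB⟩ := hA
    obtain ⟨C, rfl⟩ := (Matrix.reindexRingEquiv S (finSumFinEquiv (m := k) (n := 1))).surjective B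
    obtain ⟨C₁, C₂, C₃, C₄, rfl⟩ : ∃ C₁ C₂ C₃ C₄, C = fromBlocks C₁ C₂ C₃ C₄ :=
      ⟨_, _, _, _, (Matrix.fromBlocks_toBlocks C).symm⟩
    obtain ⟨D, hD⟩ := isUnit_one_add_nsmul (R := R) (p := p) hn C₄
    obtain ⟨A', hA'⟩ := isUnit_one_add_nsmul (R := R) (p := p) hn
      (C₁ - C₂ * D⁻¹.val * ((p ^ n : ℕ) • C₃))
    obtain ⟨u, hu, hdet⟩ := ih A' ⟨_, hA'⟩
    refine ⟨u * D, mul_mem hu ⟨_, hD⟩, fun m φ => ?_⟩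
    have key : A = upperBlock (((p ^ n : ℕ) • C₂) * D⁻¹.val) * blockDiag A' D *
        lowerBlock (D⁻¹.val * ((p ^ n : ℕ) • C₃)) := by
      ext1
      rw [Units.val_mul, Units.val_mul, hB]
      simp only [upperBlock, lowerBlock, blockDiag]
      rw [← map_mul, ← map_mul, ← map_nsmul,
        ← map_one (Matrix.reindexRingEquiv S (finSumFinEquiv (m := k) (n := 1))), ← map_add]
      congr 1
      have h1 : D.val * (D⁻¹.val * ((p ^ n : ℕ) • C₃)) = (p ^ n : ℕ) • C₃ := by
        rw [← Matrix.mul_assoc, Units.mul_inv, Matrix.one_mul]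
      have h2 : (p ^ n : ℕ) • C₂ * D⁻¹.val * D.val = (p ^ n : ℕ) • C₂ := by
        rw [Matrix.mul_assoc, Units.inv_mul, Matrix.mul_one]
      simp only [fromBlocks_multiply, Matrix.one_mul, Matrix.mul_one, Matrix.zero_mul,
        Matrix.mul_zero, zero_add, add_zero, h2]
      rw [h1, hA', hD, ← Matrix.fromBlocks_one, Matrix.fromBlocks_smul, Matrix.fromBlocks_add]
      congr 1
      · rw [smul_sub, Matrix.smul_mul, ← Matrix.mul_assoc]
        abel
      · simp
      · simp
    rw [key, map_mul, map_mul, detGLn_of_mem_E φ (upperBlock_mem _),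
      detGLn_of_mem_E φ (lowerBlock_mem _), detGLn_blockDiag, hdet, map_mul, one_mul, mul_one]

end Elimination

/-! ### Convergence in congruence subgroups -/

section Convergence

theorem mem_span_pow_smul_top_iff {R : Type*} [CommRing R] (p n : ℕ) (x : R) :
    x ∈ (Ideal.span {(p : R)} ^ n • (⊤ : Submodule R R)) ↔ (p : R) ^ n ∣ x := by
  rw [smul_eq_mul, Ideal.mul_top, Ideal.span_singleton_pow, Ideal.mem_span_singleton]

theorem coeff_nsmul_apply {R G : Type*} [CommRing R] [Group G] (q : ℕ) (x : MonoidAlgebra R G)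
    (g : G) : (q • x).coeff g = (q : R) * x.coeff g := by
  rw [← Nat.cast_smul_eq_nsmul R, MonoidAlgebra.coeff_smul, Finsupp.smul_apply, smul_eq_mul]

variable {R G : Type*} [CommRing R] [Group G] [Finite G] {p : ℕ}
  [IsAdicComplete (Ideal.span {(p : R)}) R]

/-- Matrices over `R[G]` form a `p`-adically complete group, since `G` is finite. -/
theorem exists_matrix_limit {k : ℕ} (f : ℕ → Matrix (Fin k) (Fin k) (MonoidAlgebra R G))
    (hf : ∀ n, ∃ b, f (n + 1) = f n + (p ^ n : ℕ) • b) :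
    ∃ l, ∀ n, ∃ b, l = f n + (p ^ n : ℕ) • b := by
  choose b hb using hf
  have lim : ∀ i j g, ∃ l : R, ∀ n, ∃ c, l = (f n i j).coeff g + (p : R) ^ n * c := by
    intro i j g
    have step : ∀ m d, (p : R) ^ m ∣ (f (m + d) i j).coeff g - (f m i j).coeff g := by
      intro m d
      induction d with
      | zero => simp
      | succ d ih =>
        have h : (f (m + (d + 1)) i j).coeff g - (f m i j).coeff g =
            ((f (m + d) i j).coeff g - (f m i j).coeff g) +
              (p : R) ^ (m + d) * (b (m + d) i j).coeff g := by
          rw [← add_assoc, hb (m + d), Matrix.add_apply, Matrix.smul_apply, MonoidAlgebra.coeff_add,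
            Finsupp.add_apply, coeff_nsmul_apply, Nat.cast_pow]
          ring
        rw [h]
        exact dvd_add ih ((pow_dvd_pow _ (Nat.le_add_right m d)).mul_right _)
    obtain ⟨l, hl⟩ := IsPrecomplete.prec (I := Ideal.span {(p : R)}) (M := R) inferInstance
      (f := fun n => (f n i j).coeff g) (fun {m n} h => by
        obtain ⟨d, rfl⟩ := Nat.exists_eq_add_of_le h
        exact (SModEq.sub_mem.2 ((mem_span_pow_smul_top_iff p m _).2 (step m d))).symm)
    refine ⟨l, fun n => ?_⟩
    obtain ⟨c, hc⟩ := (mem_span_pow_smul_top_iff p n _).1 (SModEq.sub_mem.1 (hl n).symm)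
    exact ⟨c, by rw [← hc]; ring⟩
  choose l c hc using lim
  refine ⟨Matrix.of fun i j => .ofCoeff (Finsupp.equivFunOnFinite.symm (l i j)), fun n =>
    ⟨Matrix.of fun i j => .ofCoeff (Finsupp.equivFunOnFinite.symm fun g => c i j g n), ?_⟩⟩
  ext i j g
  rw [Matrix.add_apply, Matrix.smul_apply, MonoidAlgebra.coeff_add, Finsupp.add_apply,
    coeff_nsmul_apply, Nat.cast_pow]
  exact hc i j g n

/-- Infinite products in `GL_k(R[G])` whose factors tend `p`-adically to `1` converge. -/
theorem exists_units_limit {k : ℕ} (u : ℕ → GLn (MonoidAlgebra R G) k)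
    (hu : ∀ n, (u n)⁻¹ * u (n + 1) ∈ congUnits _ p n) :
    ∃ v : GLn (MonoidAlgebra R G) k, ∀ n, n ≠ 0 → (u n)⁻¹ * v ∈ congUnits _ p n := by
  obtain ⟨l, hl⟩ := exists_matrix_limit (p := p) (fun n => (u n).val) (fun n => by
    obtain ⟨b, hb⟩ := hu n
    refine ⟨(u n).val * b, ?_⟩
    have h : (u (n + 1)).val = (u n).val * ((u n)⁻¹ * u (n + 1)).val := by
      rw [← Units.val_mul, mul_inv_cancel_left]
    rw [h, hb, mul_add, mul_one, mul_smul_comm])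
  have key : ∀ n, ∃ b, (u n)⁻¹.val * l = 1 + (p ^ n : ℕ) • b := by
    intro n
    obtain ⟨b, hb⟩ := hl n
    exact ⟨(u n)⁻¹.val * b, by rw [hb, mul_add, Units.inv_mul, mul_smul_comm]⟩
  have hunit : IsUnit l := by
    obtain ⟨b, hb⟩ := key 1
    rw [← (u 1).mul_inv_cancel_left l, hb]
    exact (u 1).isUnit.mul (isUnit_one_add_nsmul (R := R) one_ne_zero b)
  exact ⟨hunit.unit, fun n _ => key n⟩

end Convergence

/-! ### Separation of the determinants -/

section Separation

/-- In an algebraic extension of the fraction field of a `p`-adically separated domain `R`, finitely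
generated `R`-submodules are `p`-adically separated: a linear functional maps such a submodule into
some `b⁻¹ R`. -/
theorem eq_zero_of_forall_exists_pow_smul {R : Type*} [CommRing R] [IsDomain R] {p : ℕ}
    [IsHausdorff (Ideal.span {(p : R)}) R] (N : Type*) [Field N] [Algebra R N]
    [IsFractionRing R N] {L : Type*} [Field L] [Algebra N L] [Algebra R L] [IsScalarTower R N L]
    {W : Submodule R L} (hW : W.FG) {y : L} (hy : ∀ n : ℕ, ∃ w ∈ W, y = (p ^ n : ℕ) • w) :
    y = 0 := by
  refine (Module.forall_dual_apply_eq_zero_iff N y).1 fun f => ?_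
  obtain ⟨s, hs⟩ := hW.map (f.restrictScalars R)
  obtain ⟨b, hb⟩ := IsLocalization.exist_integer_multiples_of_finset (nonZeroDivisors R) s
  have hint : ∀ w ∈ W, ∃ r, algebraMap R N r = (b : R) • f w := by
    intro w hw
    have h : W.map (f.restrictScalars R) ≤
        (LinearMap.range (Algebra.linearMap R N)).comap (LinearMap.lsmul R N (b : R)) := by
      rw [← hs, Submodule.span_le]
      exact fun a ha => hb a ha
    exact h ⟨w, hw, rfl⟩
  obtain ⟨w₀, hw₀, h₀⟩ := hy 0
  obtain ⟨r, hr⟩ := hint y (by rw [h₀]; simpa using hw₀)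
  have hr0 : r = 0 := by
    refine IsHausdorff.haus (I := Ideal.span {(p : R)}) inferInstance r fun n => ?_
    rw [SModEq.zero, mem_span_pow_smul_top_iff]
    obtain ⟨w, hw, h⟩ := hy n
    obtain ⟨t, ht⟩ := hint w hw
    refine ⟨t, IsFractionRing.injective R N ?_⟩
    rw [hr, h, map_nsmul, smul_comm, ← ht, map_mul]
    simp
  rw [hr0, map_zero, eq_comm, Algebra.smul_def] at hr
  exact (mul_eq_zero.1 hr).resolve_left
    ((map_ne_zero_iff _ (IsFractionRing.injective R N)).2 (nonZeroDivisors.ne_zero b.2))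

variable {R L : Type*} [CommRing R] [CommRing L] [Algebra R L] {q : ℕ}

theorem exists_prod_eq_add_smul {ι : Type*} {V : Submodule R L} (s : Finset ι) (a c : ι → L)
    (ha : ∀ i, a i ∈ V) (hc : ∀ i, c i ∈ V) (hac : ∀ i, ∃ w ∈ V, a i = c i + q • w) :
    ∏ i ∈ s, a i ∈ V ^ s.card ∧ ∃ w ∈ V ^ s.card, ∏ i ∈ s, a i = ∏ i ∈ s, c i + q • w := by
  classical
  induction s using Finset.induction_on with
  | empty => exact ⟨Submodule.mem_one.2 ⟨1, by simp⟩, 0, zero_mem _, by simp⟩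
  | insert i s hi ih =>
    obtain ⟨h1, w, hw, h2⟩ := ih
    obtain ⟨v, hv, h3⟩ := hac i
    rw [Finset.prod_insert hi, Finset.prod_insert hi, Finset.card_insert_of_notMem hi, pow_succ']
    refine ⟨Submodule.mul_mem_mul (ha i) h1, c i * w + v * ∏ i ∈ s, a i,
      add_mem (Submodule.mul_mem_mul (hc i) hw) (Submodule.mul_mem_mul hv h1), ?_⟩
    calc a i * ∏ i ∈ s, a i = c i * (∏ i ∈ s, a i) + q • (v * ∏ i ∈ s, a i) := by
          rw [h3, add_mul, smul_mul_assoc]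
      _ = _ := by rw [h2, mul_add, mul_smul_comm, smul_add, add_assoc]

/-- `det (1 + q B) ≡ 1` modulo `q` times a finitely generated module that does not depend on `q`
and `B`. -/
theorem exists_det_one_add_smul {κ : Type*} [Fintype κ] [DecidableEq κ] {V : Submodule R L}
    (h1 : (1 : L) ∈ V) (B : Matrix κ κ L) (hB : ∀ i j, B i j ∈ V) :
    ∃ w ∈ V ^ Fintype.card κ, (1 + q • B).det = 1 + q • w := by
  have hone : ∀ i j, (1 : Matrix κ κ L) i j ∈ V := by
    intro i j
    rw [Matrix.one_apply]
    split_ifs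
    exacts [h1, zero_mem _]
  have key := fun σ : Equiv.Perm κ => (exists_prod_eq_add_smul (q := q) Finset.univ
    (fun i => (1 + q • B) (σ i) i) (fun i => (1 : Matrix κ κ L) (σ i) i)
    (fun i => add_mem (hone _ _) (nsmul_mem (hB _ _) q)) (fun i => hone _ _)
    (fun i => ⟨B (σ i) i, hB _ _, rfl⟩)).2
  choose w hw hdet using key
  refine ⟨∑ σ, Equiv.Perm.sign σ • w σ, sum_mem fun σ _ => ?_, ?_⟩
  · rw [Units.smul_def]
    exact zsmul_mem (hw σ) _
  · rw [Matrix.det_apply, ← Matrix.det_one (n := κ) (R := L), Matrix.det_apply, Finset.smul_sum,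
      ← Finset.sum_add_distrib]
    refine Finset.sum_congr rfl fun σ _ => ?_
    rw [hdet, smul_add, smul_comm q]

end Separation

section

variable {R L G : Type*} [CommRing R] [Field L] [Algebra R L] [Group G]

/-- For each representation `ρ`, the determinants of `1 + pⁿ B` at `ρ` lie in `1 + pⁿ W`, where `W`
is spanned by products of entries of the matrices `ρ(g)`. -/
theorem exists_fg_forall_detGLn_repMat [Finite G] {m : ℕ} (ρ : Representation L G (Fin m → L))
    (p k : ℕ) :
    ∃ W : Submodule R L, W.FG ∧ ∀ (n : ℕ) (u : GLn (MonoidAlgebra R G) k),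
      u ∈ congUnits _ p n →
        ∃ w ∈ W, (detGLn (repMat R ρ) k u).val = 1 + (p ^ n : ℕ) • w := by
  let V : Submodule R L := Submodule.span R
    (insert 1 (Set.range fun x : G × Fin m × Fin m => LinearMap.toMatrix' (ρ x.1) x.2.1 x.2.2))
  have hV : V.FG := Submodule.fg_span ((Set.finite_range _).insert _)
  refine ⟨V ^ Fintype.card (Fin k × Fin m), hV.pow _, fun n u ⟨b, hb⟩ => ?_⟩
  let B := Matrix.compRingEquiv (Fin k) (Fin m) L ((repMat R ρ).mapMatrix b)
  have hB : ∀ i j, B i j ∈ V := by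
    rintro ⟨i, s⟩ ⟨j, t⟩
    change repMat R ρ (b i j) s t ∈ V
    rw [repMat_apply, Finsupp.sum, Matrix.sum_apply]
    exact sum_mem fun g _ => V.smul_mem _
      (Submodule.subset_span (Set.mem_insert_of_mem _ ⟨(g, s, t), rfl⟩))
  obtain ⟨w, hw, h⟩ := exists_det_one_add_smul (q := p ^ n)
    (Submodule.subset_span (Set.mem_insert _ _)) B hB
  refine ⟨w, hw, ?_⟩
  rw [← h]
  change (Matrix.compRingEquiv (Fin k) (Fin m) L ((repMat R ρ).mapMatrix u.val)).det = _
  rw [hb, map_add, map_add, map_one, map_one, map_nsmul, map_nsmul]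

end

/-! ### The completions -/

section Completion

variable {R L G : Type*} [CommRing R] [Field L] [Algebra R L] [Group G] {p : ℕ}

variable (R L G) in
/-- `Det` on `k × k` matrices, with values in `Det(K₁(R[G]))`. -/
noncomputable def detGL (k : ℕ) : GLn (MonoidAlgebra R G) k →* DetK1 R L G :=
  ((Det.toImage R L G).comp (K1.mk _)).comp (StGL.of _ k)

theorem detGL_mem_DetCong {n k : ℕ} {u : GLn (MonoidAlgebra R G) k} (hu : u ∈ congUnits _ p n) :
    detGL R L G k u ∈ DetCong R L G p n :=
  ⟨StGL.of _ k u, (of_mem_congGL_iff_mem_congUnits R G p n k u).2 hu, rfl⟩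

/-- The kernel of `Det(K₁(R[G])) → Det(GL(R[G])) / Det(1 + pⁿ M(R[G]))`, pulled back to
`K₁(R[G])`, is generated by `SK₁(R[G])` and the kernel of reduction modulo `pⁿ`. -/
theorem toImage_mem_DetCong_iff {n : ℕ} {x : K1 (MonoidAlgebra R G)} :
    Det.toImage R L G x ∈ DetCong R L G p n ↔
      ∃ s ∈ SK1 R L G, K1.map (red R G p n) s = K1.map (red R G p n) x := by
  constructor
  · rintro ⟨c, hc, hcx⟩
    have hker : K1.map (red R G p n) (K1.mk _ c) = 1 := by
      rw [← MonoidHom.mem_ker, K1.ker_map_red]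
      exact ⟨c, hc, rfl⟩
    refine ⟨x * (K1.mk _ c)⁻¹, ?_, by rw [map_mul, map_inv, hker, inv_one, mul_one]⟩
    have h : Det R L G (K1.mk _ c) = Det R L G x := congrArg Subtype.val hcx
    rw [SK1, MonoidHom.mem_ker, map_mul, map_inv, h, mul_inv_cancel]
  · rintro ⟨s, hs, hsx⟩
    obtain ⟨c, hc, hcx⟩ : x * s⁻¹ ∈ (congGL R G p n).map (K1.mk _) := by
      rw [← K1.ker_map_red, MonoidHom.mem_ker, map_mul, map_inv, hsx, mul_inv_cancel]
    refine ⟨c, hc, ?_⟩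
    have h1 : Det.toImage R L G s = 1 := Subtype.ext hs
    change Det.toImage R L G (K1.mk _ c) = _
    rw [hcx, map_mul, map_inv, h1, inv_one, mul_one]

/-- The subgroups of `K̂₁(R[G])` of elements with trivial `n`-th component form a neighbourhood basis
of `1`. -/
theorem mem_SK1Hat_iff (x : K1Hat R G p) :
    x ∈ SK1Hat R L G p ↔ ∀ n, ∃ s ∈ SK1 R L G, K1.map (red R G p n) s = x.val n := by
  change x ∈ closure _ ↔ _
  constructor
  · intro hx n
    have hopen : IsOpen {y : K1Hat R G p | y.val n = x.val n} :=
      (isOpen_discrete {z | z = x.val n}).preimage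
        (f := fun y : K1Hat R G p => y.val n) ((continuous_apply n).comp continuous_subtype_val)
    obtain ⟨_, hy, s, hs, rfl⟩ := mem_closure_iff.1 hx _ hopen rfl
    exact ⟨s, hs, hy⟩
  · intro hx
    rw [mem_closure_iff]
    intro o ho hxo
    obtain ⟨o, hopen, rfl⟩ := isOpen_induced_iff.1 ho
    obtain ⟨I, t, ht, hto⟩ := isOpen_pi_iff.1 hopen _ hxo
    -- the component at `n` determines the earlier ones
    obtain ⟨s, hs, hsx⟩ := hx (I.sup id)
    refine ⟨K1.toHat R G p s, hto fun m hm => ?_, s, hs, rfl⟩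
    have hle : m ≤ I.sup id := Finset.le_sup (f := id) hm
    have h : (K1.toHat R G p s).val m = x.val m := by
      rw [← x.2 m _ hle, ← hsx]
      exact ((K1.toHat R G p s).2 m _ hle).symm
    rw [h]
    exact (ht m hm).2

variable [Finite G] [IsAdicComplete (Ideal.span {(p : R)}) R]

/-- `Det(1 + pⁿ M(R[G])) = Det(1 + pⁿ R[G])` for `n ≥ 1`. -/
theorem exists_detGL_one_eq_of_mem_DetCong {n : ℕ} (hn : n ≠ 0) {d : DetK1 R L G}
    (hd : d ∈ DetCong R L G p n) :
    ∃ u : GLn (MonoidAlgebra R G) 1, u ∈ congUnits _ p n ∧ detGL R L G 1 u = d := by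
  obtain ⟨x, hx, rfl⟩ := hd
  obtain ⟨k, A, rfl⟩ := StGL.exists_of x
  obtain ⟨u, hu, hdet⟩ := exists_detGLn_eq_of_mem_congUnits L (R := R) hn k A
    ((of_mem_congGL_iff_mem_congUnits R G p n k A).1 hx)
  exact ⟨u, hu, Subtype.ext (funext fun χ => (hdet _ (repMat R χ.rep)).symm)⟩

theorem DetK1.toHat_injective [IsDomain R] (N : Type*) [Field N] [Algebra R N]
    [IsFractionRing R N] [Algebra N L] [IsScalarTower R N L] :
    Function.Injective (DetK1.toHat R L G p) := by
  rw [injective_iff_map_eq_one]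
  intro d hd
  have hmem : ∀ n, d ∈ DetCong R L G p n := fun n =>
    (QuotientGroup.eq_one_iff d).1 (congrFun (congrArg Subtype.val hd) n)
  refine Subtype.ext (funext fun χ => Units.ext ?_)
  obtain ⟨W, hW, hdet⟩ := exists_fg_forall_detGLn_repMat (R := R) χ.rep p 1
  change (d.val χ).val = 1
  rw [← sub_eq_zero]
  refine eq_zero_of_forall_exists_pow_smul (p := p) N hW fun n => ?_
  obtain ⟨u, hu, rfl⟩ := exists_detGL_one_eq_of_mem_DetCong n.succ_ne_zero (hmem (n + 1))
  obtain ⟨w, hw, h⟩ := hdet (n + 1) u hu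
  refine ⟨p • w, nsmul_mem hw p, ?_⟩
  change (detGLn (repMat R χ.rep) 1 u).val - 1 = _
  rw [h, add_sub_cancel_left, smul_smul, pow_succ]

theorem DetK1.toHat_surjective : Function.Surjective (DetK1.toHat R L G p) := by
  intro y
  choose z hz using fun n => QuotientGroup.mk_surjective (y.val n)
  have hstep : ∀ n, (z (n + 1))⁻¹ * z (n + 2) ∈ DetCong R L G p (n + 1) := by
    intro n
    refine QuotientGroup.eq.1 ?_
    have h := y.2 (n + 1) (n + 2) (Nat.le_succ _)
    rw [← hz, ← hz] at h
    exact h.symm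
  choose c hc hcz using fun n => exists_detGL_one_eq_of_mem_DetCong n.succ_ne_zero (hstep n)
  -- `z (n + 1) = z 1 * Det (c 0 * ⋯ * c (n - 1))`, so the infinite product of the `c n` yields `y`
  let u : ℕ → GLn (MonoidAlgebra R G) 1 := fun n => Nat.rec 1 (fun n v => v * c n) n
  have hu : ∀ n, (u n)⁻¹ * u (n + 1) = c n := fun n => inv_mul_cancel_left _ _
  have huz : ∀ n, z (n + 1) = z 1 * detGL R L G 1 (u n) := by
    intro n
    induction n with
    | zero => rw [show u 0 = 1 from rfl, map_one, mul_one]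
    | succ n ih =>
      rw [show u (n + 1) = u n * c n from rfl, map_mul, hcz, ← mul_assoc, ← ih,
        mul_inv_cancel_left]
  obtain ⟨v, hv⟩ := exists_units_limit (p := p) u (fun n => by
    obtain ⟨b, hb⟩ := hc n
    exact hu n ▸ ⟨p • b, by rw [hb, smul_smul, pow_succ]⟩)
  refine ⟨z 1 * detGL R L G 1 v, Subtype.ext (funext fun n => ?_)⟩
  change QuotientGroup.mk (z 1 * detGL R L G 1 v) = y.val n
  rw [← y.2 n (n + 1) n.le_succ, ← hz (n + 1)]
  refine QuotientGroup.eq.2 (inv_mem_iff.1 (DetCong_anti R L G p n.le_succ ?_))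
  have h : (z 1 * detGL R L G 1 v)⁻¹ * z (n + 1) = (detGL R L G 1 ((u n)⁻¹ * v))⁻¹ := by
    rw [huz n, map_mul, map_inv, mul_inv_rev, mul_inv_rev, inv_inv, mul_assoc,
      inv_mul_cancel_left]
  change ((z 1 * detGL R L G 1 v)⁻¹ * z (n + 1))⁻¹ ∈ _
  rw [h, inv_inv]
  refine detGL_mem_DetCong ?_
  have h2 : (u n)⁻¹ * v = c n * ((u (n + 1))⁻¹ * v) := by
    rw [← hu n, mul_assoc, mul_inv_cancel_left]
  rw [h2]
  exact mul_mem (hc n) (hv (n + 1) n.succ_ne_zero)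

variable (R L G p) in
/-- The homomorphisms `K₁(R_n[G]) → Det(GL(R[G])) / Det(1 + pⁿ M(R[G]))` induced by `Det`. -/
theorem existsUnique_detMod :
    ∃! d : ∀ n : ℕ, K1 (MonoidAlgebra (Rmod R p n) G) →* DetMod R L G p n,
      ∀ (n : ℕ) (x : K1 (MonoidAlgebra R G)),
        d n (K1.map (red R G p n) x) = QuotientGroup.mk (Det.toImage R L G x) := by
  have hker : ∀ n, (K1.map (red R G p n)).ker ≤
      ((QuotientGroup.mk' (DetCong R L G p n)).comp (Det.toImage R L G)).ker := by
    intro n x hx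
    refine (QuotientGroup.eq_one_iff _).2 (toImage_mem_DetCong_iff.2 ⟨1, one_mem _, ?_⟩)
    rw [map_one]
    exact hx.symm
  refine ⟨fun n => (K1.map (red R G p n)).liftOfSurjective (K1.map_red_surjective n) ⟨_, hker n⟩,
    fun n x => MonoidHom.liftOfRightInverse_comp_apply _ _ _ ⟨_, hker n⟩ x, fun d hd => ?_⟩
  refine funext fun n => MonoidHom.ext fun x => ?_
  obtain ⟨x, rfl⟩ := K1.map_red_surjective n x
  rw [hd]
  exact (MonoidHom.liftOfRightInverse_comp_apply _ _ _ ⟨_, hker n⟩ x).symm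

theorem exists_mulExact_of_detMod
    (d : ∀ n : ℕ, K1 (MonoidAlgebra (Rmod R p n) G) →* DetMod R L G p n)
    (hd : ∀ (n : ℕ) (x : K1 (MonoidAlgebra R G)),
      d n (K1.map (red R G p n) x) = QuotientGroup.mk (Det.toImage R L G x)) :
    ∃ D : K1Hat R G p →* DetHat R L G p,
      (∀ (x : K1Hat R G p) (n : ℕ), (D x).val n = d n (x.val n)) ∧
      Function.Injective (SK1Hat R L G p).subtype ∧
      Function.MulExact (SK1Hat R L G p).subtype D ∧ Function.Surjective D := by
  let D : K1Hat R G p →* DetHat R L G p :=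
    (MonoidHom.pi fun n => (d n).comp ((Pi.evalMonoidHom _ n).comp (K1Hat R G p).subtype)).codRestrict
      (DetHat R L G p) (fun x m n h => by
        change DetMod.trans R L G p h (d n (x.val n)) = d m (x.val m)
        obtain ⟨y, hy⟩ := K1.map_red_surjective n (x.val n)
        rw [← x.2 m n h, ← hy, hd, ← K1.map_comp, trans_comp_red, hd]
        rfl)
  have hD : ∀ (x : K1Hat R G p) (n : ℕ), (D x).val n = d n (x.val n) := fun x n => rfl
  refine ⟨D, hD, Subtype.val_injective, fun x => ?_, fun y => ?_⟩
  · have h1 : D x = 1 ↔ ∀ n, d n (x.val n) = 1 := by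
      rw [Subtype.ext_iff, funext_iff]
      rfl
    rw [h1, Subgroup.coe_subtype, Subtype.range_coe, SetLike.mem_coe, mem_SK1Hat_iff]
    refine forall_congr' fun n => ?_
    obtain ⟨y, hy⟩ := K1.map_red_surjective n (x.val n)
    rw [← hy, hd, ← toImage_mem_DetCong_iff]
    exact QuotientGroup.eq_one_iff _
  · obtain ⟨z, rfl⟩ := DetK1.toHat_surjective y
    obtain ⟨x, rfl⟩ := (Det R L G).rangeRestrict_surjective z
    exact ⟨K1.toHat R G p x, Subtype.ext (funext fun n => hd n x)⟩

end Completion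

end GroupRingK1

theorem proposition1p2 (p : ℕ) (hp : p.Prime)
    (R : Type*) [CommRing R] [IsDomain R] [CharZero R] [IsAdicComplete (Ideal.span {(p : R)}) R]
    (F : R →+* R) (hF : ∀ r : R, F r - r ^ p ∈ Ideal.span {(p : R)})
    (N : Type*) [Field N] [Algebra R N] [IsFractionRing R N]
    (Nc : Type*) [Field Nc] [Algebra N Nc] [IsAlgClosure N Nc] [Algebra R Nc] [IsScalarTower R N Nc]
    (G : Type*) [Group G] [Finite G] :
    -- the natural map `Det(K₁(R[G])) → D̂et(K₁(R[G]))` is an isomorphism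
    Function.Bijective (GroupRingK1.DetK1.toHat R Nc G p) ∧
    -- `Det` induces unique maps `K₁(R_n[G]) → Det(GL(R[G])) / Det(1 + pⁿ M(R[G]))`
    (∃! d : ∀ n : ℕ, GroupRingK1.K1 (MonoidAlgebra (GroupRingK1.Rmod R p n) G) →*
        GroupRingK1.DetMod R Nc G p n,
      ∀ (n : ℕ) (x : GroupRingK1.K1 (MonoidAlgebra R G)),
        d n (GroupRingK1.K1.map (GroupRingK1.red R G p n) x) =
          QuotientGroup.mk (GroupRingK1.Det.toImage R Nc G x)) ∧
    -- their inverse limit `D : K̂₁(R[G]) → D̂et(K₁(R[G]))` exists, and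
    -- `1 → SK̂₁(R[G]) → K̂₁(R[G]) → D̂et(K₁(R[G])) → 1` is exact
    (∀ d : ∀ n : ℕ, GroupRingK1.K1 (MonoidAlgebra (GroupRingK1.Rmod R p n) G) →*
        GroupRingK1.DetMod R Nc G p n,
      (∀ (n : ℕ) (x : GroupRingK1.K1 (MonoidAlgebra R G)),
        d n (GroupRingK1.K1.map (GroupRingK1.red R G p n) x) =
          QuotientGroup.mk (GroupRingK1.Det.toImage R Nc G x)) →
      ∃ D : GroupRingK1.K1Hat R G p →* GroupRingK1.DetHat R Nc G p,
        (∀ (x : GroupRingK1.K1Hat R G p) (n : ℕ), (D x).val n = d n (x.val n)) ∧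
        Function.Injective (GroupRingK1.SK1Hat R Nc G p).subtype ∧
        Function.MulExact (GroupRingK1.SK1Hat R Nc G p).subtype D ∧
        Function.Surjective D) := by
  exact ⟨⟨GroupRingK1.DetK1.toHat_injective N, GroupRingK1.DetK1.toHat_surjective⟩,
    GroupRingK1.existsUnique_detMod R Nc G p, GroupRingK1.exists_mulExact_of_detMod⟩
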